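/- Let $(\varepsilon_t)_{t\ge1}$ be i.i.d. real random variables with mean zero and finite variance $\sigma^2>0$, let $Y_0$ be a real random variable independent of $(\varepsilon_t)_{t\ge 1}$, let $\alpha,\beta,\gamma,\delta,r\in\mathbb R$, and for $t\ge1$ let $$Y_t=\begin{cases}\gamma+\alpha Y_{t-1}+\varepsilon_t,& Y_{t-1}>r,\\ \delta+\beta Y_{t-1}+\varepsilon_t,& Y_{t-1}\le r.\end{cases}$$ Assume $\gamma=\delta=0$ and one of the following conditions: (H1) $\alpha>1$, $\beta\le1$, $r=0$ and $\mathbb E Y_0^2<\infty$; (H2) $\alpha>1$, $\beta\le1$, $r\neq0$, $\mathbb E Y_0^2<\infty$ and $\mathbb P(\varepsilon_1\le x)<1$ for every $x\in\mathbb R$. Then: (1) $\mathbb E|Y_n|<\infty$ for all $n$, and $\mathbb E|Y_n|=O(\alpha^n)$ as $n\to\infty$. (2) $\sum_{t=0}^\infty I\{Y_t\le r\}<\infty$ almost surely; hence $m_k=\sum_{t=k}^\infty I\{Y_t\le r\}$ is almost surely finite for every $k\ge0$. (3) Put $$\xi=\sum_{k=1}^\infty \alpha^{-k}\Bigl(\frac{\beta}{\alpha}\Bigr)^{m_k}\varepsilon_k+\Bigl(\frac{\beta}{\alpha}\Bigr)^{m_0}Y_0\quad\text{if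 }\beta\ne0,$$ $$\xi=\sum_{k=1}^\infty \frac{\prod_{t=k}^\infty I\{Y_t>r\}}{\alpha^{k}}\,\varepsilon_k+\Bigl(\prod_{t=0}^\infty I\{Y_t>r\}\Bigr)Y_0\quad\text{if }\beta=0.$$ The series converges absolutely almost surely, $Y_n/\alpha^n\to\xi$ almost surely, and $\xi>0$ almost surely. -/

import Mathlib

open MeasureTheory ProbabilityTheory Filter Topology Asymptotics

namespace ThresholdAR

variable {Ω : Type*}

/-- The threshold autoregressive process of order one with regimes `(γ, α)` (strictly above the
threshold `r`) and `(δ, β)` (at or below `r`), started at `Y₀` and driven by `ε 1, ε 2, …`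
(the variable `ε 0` is never used). -/
noncomputable def tar (γ δ α β r : ℝ) (Y₀ : Ω → ℝ) (ε : ℕ → Ω → ℝ) : ℕ → Ω → ℝ
  | 0, ω => Y₀ ω
  | t + 1, ω =>
      if r < tar γ δ α β r Y₀ ε t ω then γ + α * tar γ δ α β r Y₀ ε t ω + ε (t + 1) ω
      else δ + β * tar γ δ α β r Y₀ ε t ω + ε (t + 1) ω

/-- The standing assumptions on the data of the model: the innovations `ε 1, ε 2, …` are i.i.d.
with mean zero and finite variance `σ² > 0`, and the random variable `Y₀` is independent of the
whole sequence `(ε t)_{t ≥ 1}`. -/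
structure StandingAssumptions [MeasurableSpace Ω] (P : Measure Ω) (σ : ℝ) (Y₀ : Ω → ℝ)
    (ε : ℕ → Ω → ℝ) : Prop where
  measurable_init : Measurable Y₀
  measurable_noise : ∀ t, 1 ≤ t → Measurable (ε t)
  iIndep_noise : iIndepFun (fun t : ℕ => ε (t + 1)) P
  identDistrib_noise : ∀ t, 1 ≤ t → IdentDistrib (ε t) (ε 1) P P
  memLp_noise : MemLp (ε 1) 2 P
  mean_noise : ∫ ω, ε 1 ω ∂P = 0
  variance_pos : 0 < σ
  variance_noise : variance (ε 1) P = σ ^ 2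
  indep_init : IndepFun Y₀ (fun ω (t : ℕ) => ε (t + 1) ω) P

/-- Explosive upper regime with threshold zero and square-integrable initial value. -/
def H1 [MeasurableSpace Ω] (P : Measure Ω) (α β r : ℝ) (Y₀ : Ω → ℝ) : Prop :=
  1 < α ∧ β ≤ 1 ∧ r = 0 ∧ Integrable (fun ω => Y₀ ω ^ 2) P

/-- Explosive upper regime with nonzero threshold, square-integrable initial value, and
innovations that are unbounded above. -/
def H2 [MeasurableSpace Ω] (P : Measure Ω) (α β r : ℝ) (Y₀ : Ω → ℝ) (ε : ℕ → Ω → ℝ) : Prop :=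
  1 < α ∧ β ≤ 1 ∧ r ≠ 0 ∧ Integrable (fun ω => Y₀ ω ^ 2) P ∧
    ∀ x : ℝ, P {ω | ε 1 ω ≤ x} < 1

/-- `m_k = ∑_{t ≥ k} I{Y_t ≤ r}`, the number (possibly infinite) of times `t ≥ k` at which the
path is at or below `r`. -/
noncomputable def visits (r : ℝ) (Y : ℕ → Ω → ℝ) (k : ℕ) (ω : Ω) : ℕ∞ :=
  {t : ℕ | k ≤ t ∧ Y t ω ≤ r}.encard

/-- `∏_{t ≥ k} I{Y_t > r}`. -/
noncomputable def aboveProd (r : ℝ) (Y : ℕ → Ω → ℝ) (k : ℕ) (ω : Ω) : ℝ :=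
  ∏' j : ℕ, if r < Y (k + j) ω then (1 : ℝ) else 0

open Classical in
/-- The weight at index `k` in the limiting series: `α^{-k} (β/α)^{m_k}` if `β ≠ 0`, and
`α^{-k} ∏_{t ≥ k} I{Y_t > r}` if `β = 0`. The exponent `m_k` is only meaningful where
`m_k` is finite. -/
noncomputable def weight (α β r : ℝ) (Y : ℕ → Ω → ℝ) (k : ℕ) (ω : Ω) : ℝ :=
  if β = 0 then aboveProd r Y k ω / α ^ k
  else (β / α) ^ (visits r Y k ω).toNat / α ^ k

/-- The `k`-th noise term of the limiting series, `k ≥ 1` being written as `j + 1`. -/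
noncomputable def xiTerm (α β r : ℝ) (Y ε : ℕ → Ω → ℝ) (j : ℕ) (ω : Ω) : ℝ :=
  weight α β r Y (j + 1) ω * ε (j + 1) ω

/-- The limiting variable `ξ = ∑_{k ≥ 1} w_k ε_k + w_0 Y_0`, `w_k` being the weights above. -/
noncomputable def xi (α β r : ℝ) (Y ε : ℕ → Ω → ℝ) (ω : Ω) : ℝ :=
  (∑' j : ℕ, xiTerm α β r Y ε j ω) + weight α β r Y 0 ω * Y 0 ω

end ThresholdAR

/-!
The initial value and the innovations form one independent sequence `X 0, X 1, …`, whose past up to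
time `n` is a filtration. All almost sure statements about the path rest on one consequence of
Lévy's upward theorem (`ae_mem_of_frequently`): an event of the limit σ-algebra that has conditional
probability at least `q > 0`, given the past, at infinitely many (random) times occurs almost surely.

*Escape.* By the central limit theorem and this law, the random walk of the innovations is unbounded
above. Below `min r 0` the path dominates that walk because `β ≤ 1`, so it exceeds `min r 0`
infinitely often. From there, a fixed finite pattern of large innovations lifts it above a high
level `L` (`exists_lift`), and then, with probability at least one half, the whole discounted
future noise is too small to bring it back (`IsPath.lt_add`). Both depend on the future only, so
the conditional probability of an escape is bounded below whenever the path is above `min r 0`, and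
the path is almost surely eventually above `r` (`ae_eventually_lt`).

*Growth.* The negative part of the path increases in one step by at most `|X (n + 1)|` and a
constant, so its mean grows linearly; hence `𝔼|Y (n + 1)| ≤ α * 𝔼|Y n| + O(n)`
(`integral_abs_isBigO`).

*The limit.* The weight at index `k` is the weight at index `k + 1` times the slope active at time
`k`, so the partial sums of the limiting series telescope to (weight at `n`) `* Y n`
(`sum_xiTerm_add`), and the weight at `n` is `α ^ (-n)` once the path has escaped.

*Positivity.* After the escape `Y n / α ^ n > r / α ^ n`, so the limit is nonnegative. If it
vanished on a path above `r` from time `S` on, then at every time `n ≥ S` the next innovation would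
equal a quantity determined by all the other variables. An innovation takes both signs with positive
probability, so it misses such a target with conditional probability bounded below
(`mul_measureReal_le_inter_ne`), and the same law excludes this event (`ae_not_tendsto_zero`).
-/

namespace ThresholdAR

/-! ### A conditional zero-one law -/

/-- A conditional form of Lévy's zero-one law: if, given the past up to time `n`, the event `E` has
conditional probability at least `q > 0` on the set `D n`, then almost surely `E` occurs as soon as
infinitely many of the `D n` occur. -/
theorem ae_mem_of_frequently {Ω : Type*} {m0 : MeasurableSpace Ω} {P : Measure Ω}
    [IsProbabilityMeasure P] (ℱ : Filtration ℕ m0) {E : Set Ω} (hE : MeasurableSet[⨆ n, ℱ n] E)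
    {D : ℕ → Set Ω} (hD : ∀ n, MeasurableSet[ℱ n] (D n)) {q : ℝ} (hq : 0 < q)
    (h : ∀ n A, MeasurableSet[ℱ n] A → A ⊆ D n → q * P.real A ≤ P.real (A ∩ E)) :
    ∀ᵐ ω ∂P, (∃ᶠ n in atTop, ω ∈ D n) → ω ∈ E := by
  have hle : ⨆ n, ℱ n ≤ m0 := iSup_le fun n => ℱ.le n
  have hE0 : MeasurableSet E := hle _ hE
  have hint : Integrable (E.indicator fun _ => (1 : ℝ)) P :=
    (integrable_const (1 : ℝ)).indicator hE0
  have hconv := hint.tendsto_ae_condExp (ℱ := ℱ)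
    ((@stronglyMeasurable_const _ _ (⨆ n, ℱ n) _ (1 : ℝ)).indicator hE)
  have hlow : ∀ n, ∀ᵐ ω ∂P,
      (D n).indicator (fun _ => q) ω ≤ (P[E.indicator fun _ => (1 : ℝ) | ℱ n]) ω := by
    intro n
    have hsm : StronglyMeasurable[ℱ n] ((D n).indicator fun _ => q) :=
      (@stronglyMeasurable_const _ _ (ℱ n) _ q).indicator (hD n)
    have hint' : Integrable ((D n).indicator fun _ => q) P :=
      (integrable_const q).indicator (ℱ.le n _ (hD n))
    refine ae_le_of_ae_le_trim (hm := ℱ.le n) ?_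
    refine ae_le_of_forall_setIntegral_le (hint'.trim (ℱ.le n) hsm)
      (integrable_condExp.trim (ℱ.le n) stronglyMeasurable_condExp) ?_
    intro A hA _
    rw [← setIntegral_trim (ℱ.le n) hsm hA,
      ← setIntegral_trim (ℱ.le n) stronglyMeasurable_condExp hA,
      setIntegral_condExp (ℱ.le n) hint hA, setIntegral_indicator (ℱ.le n _ (hD n)),
      setIntegral_indicator hE0, setIntegral_const, setIntegral_const]
    have h1 := h n (A ∩ D n) (hA.inter (hD n)) Set.inter_subset_right
    have h2 : P.real (A ∩ D n ∩ E) ≤ P.real (A ∩ E) :=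
      measureReal_mono (Set.inter_subset_inter_left _ Set.inter_subset_left)
    simp only [smul_eq_mul, mul_one]
    linarith
  filter_upwards [hconv, ae_all_iff.2 hlow] with ω h1 h2 hf
  by_contra hω
  rw [Set.indicator_of_notMem hω] at h1
  refine hf ?_
  filter_upwards [h1.eventually (gt_mem_nhds hq)] with n hn hmem
  have := h2 n
  rw [Set.indicator_of_mem hmem] at this
  linarith

/-! ### The σ-algebras generated by parts of an independent sequence -/

section Independence

variable {Ω : Type*} {X : ℕ → Ω → ℝ}

/-- The σ-algebra generated by the variables `X i` with `i ∈ S`. -/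
abbrev sigmaOf (X : ℕ → Ω → ℝ) (S : Set ℕ) : MeasurableSpace Ω :=
  ⨆ i ∈ S, MeasurableSpace.comap (X i) inferInstance

theorem measurable_sigmaOf {S : Set ℕ} {i : ℕ} (hi : i ∈ S) : Measurable[sigmaOf X S] (X i) :=
  measurable_iff_comap_le.2 (le_iSup₂_of_le i hi le_rfl)

theorem sigmaOf_mono {S T : Set ℕ} (h : S ⊆ T) : sigmaOf X S ≤ sigmaOf X T :=
  biSup_mono h

variable [MeasurableSpace Ω] {P : Measure Ω}

theorem sigmaOf_le (hX : ∀ i, Measurable (X i)) (S : Set ℕ) :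
    sigmaOf X S ≤ (inferInstance : MeasurableSpace Ω) :=
  iSup₂_le fun i _ => (hX i).comap_le

/-- The filtration of the past: at time `n` it is generated by `X 0, …, X n`. -/
def past (X : ℕ → Ω → ℝ) (hX : ∀ i, Measurable (X i)) :
    Filtration ℕ (inferInstance : MeasurableSpace Ω) where
  seq n := sigmaOf X (Set.Iic n)
  mono' _ _ hij := sigmaOf_mono (Set.Iic_subset_Iic.2 hij)
  le' _ := sigmaOf_le hX _

theorem sigmaOf_le_iSup_past (hX : ∀ i, Measurable (X i)) (S : Set ℕ) :
    sigmaOf X S ≤ ⨆ n, past X hX n :=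
  iSup₂_le fun i _ => le_iSup_of_le i
    (measurable_iff_comap_le.1 (measurable_sigmaOf (Set.mem_Iic.2 le_rfl)))

theorem measureReal_inter_eq_mul (hX : ∀ i, Measurable (X i)) (hind : iIndepFun X P) {S T : Set ℕ}
    (hST : Disjoint S T) {A B : Set Ω} (hA : MeasurableSet[sigmaOf X S] A)
    (hB : MeasurableSet[sigmaOf X T] B) : P.real (A ∩ B) = P.real A * P.real B := by
  have h := indep_iSup_of_disjoint (fun i => (hX i).comap_le) hind hST
  have := (Indep_iff _ _ _).1 h A B hA hB
  simp [measureReal_def, this]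

/-- A variable that is positive with probability at least `q` and negative with probability at
least `q` avoids any independent random target `Z` with conditional probability at least `q`: if
`Z ≤ 0` it does so by being positive, and otherwise by being negative. -/
theorem mul_measureReal_le_inter_ne [IsProbabilityMeasure P] (hX : ∀ i, Measurable (X i))
    (hind : iIndepFun X P) (i : ℕ)
    {q : ℝ} (hpos : q ≤ P.real {ω | 0 < X i ω}) (hneg : q ≤ P.real {ω | X i ω < 0})
    {Z : Ω → ℝ} (hZ : Measurable[sigmaOf X {i}ᶜ] Z) {A : Set Ω}
    (hA : MeasurableSet[sigmaOf X {i}ᶜ] A) :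
    q * P.real A ≤ P.real (A ∩ {ω | X i ω ≠ Z ω}) := by
  have hle := sigmaOf_le hX {i}ᶜ
  have hi : Measurable[sigmaOf X {i}] (X i) := measurable_sigmaOf (Set.mem_singleton i)
  have hd : Disjoint ({i}ᶜ : Set ℕ) {i} := disjoint_compl_left
  have hAZ : MeasurableSet[sigmaOf X {i}ᶜ] (A ∩ {ω | Z ω ≤ 0}) := hA.inter (hZ measurableSet_Iic)
  have hAZ' : MeasurableSet[sigmaOf X {i}ᶜ] (A ∩ {ω | 0 < Z ω}) := hA.inter (hZ measurableSet_Ioi)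
  have h1 := measureReal_inter_eq_mul (P := P) hX hind hd hAZ (B := {ω | 0 < X i ω})
    (hi measurableSet_Ioi)
  have h2 := measureReal_inter_eq_mul (P := P) hX hind hd hAZ' (B := {ω | X i ω < 0})
    (hi measurableSet_Iio)
  have hsplit : P.real A = P.real (A ∩ {ω | Z ω ≤ 0}) + P.real (A ∩ {ω | 0 < Z ω}) := by
    rw [← measureReal_inter_add_sdiff (s := A) (hle _ (hZ measurableSet_Iic) :
      MeasurableSet {ω | Z ω ≤ 0})]
    congr 2
    ext ω
    simp
  have hdisj : Disjoint (A ∩ {ω | Z ω ≤ 0} ∩ {ω | 0 < X i ω})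
      (A ∩ {ω | 0 < Z ω} ∩ {ω | X i ω < 0}) := by
    refine Set.disjoint_left.2 fun ω h h' => ?_
    exact lt_asymm (show 0 < X i ω from h.2) h'.2
  have hunion := measureReal_union (μ := P) hdisj
    ((hle _ hAZ').inter (hX i measurableSet_Iio))
  have hsub : P.real ((A ∩ {ω | Z ω ≤ 0} ∩ {ω | 0 < X i ω}) ∪
      (A ∩ {ω | 0 < Z ω} ∩ {ω | X i ω < 0})) ≤ P.real (A ∩ {ω | X i ω ≠ Z ω}) := by
    refine measureReal_mono ?_
    rintro ω (⟨⟨ha, hz⟩, hx⟩ | ⟨⟨ha, hz⟩, hx⟩)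
    · exact ⟨ha, (lt_of_le_of_lt hz hx).ne'⟩
    · exact ⟨ha, (lt_trans hx hz).ne⟩
  rw [hunion, h1, h2] at hsub
  rw [hsplit]
  nlinarith [measureReal_nonneg (μ := P) (s := A ∩ {ω | Z ω ≤ 0}),
    measureReal_nonneg (μ := P) (s := A ∩ {ω | 0 < Z ω})]

end Independence

/-! ### Unboundedness of the centred random walk -/

section RandomWalk

variable {Ω : Type*} [MeasurableSpace Ω] {P : Measure Ω} [IsProbabilityMeasure P]
  {X : ℕ → Ω → ℝ}

/-- By the central limit theorem, a centred nondegenerate random walk exceeds every level at some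
time with probability bounded below. -/
theorem exists_pos_le_measureReal_exists_lt_sum {ξ : ℕ → Ω → ℝ} (hind : iIndepFun ξ P)
    (hid : ∀ i, IdentDistrib (ξ i) (ξ 0) P P) (hL2 : MemLp (ξ 0) 2 P)
    (hmean : ∫ ω, ξ 0 ω ∂P = 0) (hvar : variance (ξ 0) P ≠ 0) :
    ∃ q : ℝ, 0 < q ∧ ∀ M : ℝ, q ≤ P.real {ω | ∃ n, M < ∑ i ∈ Finset.range n, ξ i ω} := by
  have hv : (variance (ξ 0) P).toNNReal ≠ 0 := by
    simpa using lt_of_le_of_ne (variance_nonneg _ _) hvar.symm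
  have hclt := (tendstoInDistribution_inv_sqrt_mul_sum_sub (Y := id)
    (HasLaw.id (μ := gaussianReal 0 (variance (ξ 0) P).toNNReal)) hL2 hind hid)
  have hlim := ProbabilityMeasure.le_liminf_measure_open_of_tendsto hclt.tendsto
    (isOpen_Ioi (a := (1 : ℝ)))
  have hpos : 0 < gaussianReal 0 (variance (ξ 0) P).toNNReal (Set.Ioi 1) := by
    refine pos_iff_ne_zero.2 fun h0 => ?_
    have := gaussianReal_absolutelyContinuous' 0 hv h0
    simp at this
  obtain ⟨q, hq0, hq⟩ := ENNReal.lt_iff_exists_nnreal_btwn.1 hpos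
  refine ⟨q, by exact_mod_cast hq0, fun M => ?_⟩
  have hlt : (q : ENNReal) < liminf (fun n : ℕ => P.map (fun ω => (√(n : ℝ))⁻¹ *
      (∑ k ∈ Finset.range n, ξ k ω - n * ∫ ω, ξ 0 ω ∂P)) (Set.Ioi (1 : ℝ))) atTop := by
    refine lt_of_lt_of_le hq ?_
    simpa using hlim
  have hev := eventually_lt_of_lt_liminf hlt
  have hM : ∀ᶠ n : ℕ in atTop, M ≤ √(n : ℝ) :=
    (Real.tendsto_sqrt_atTop.comp tendsto_natCast_atTop_atTop).eventually_ge_atTop M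
  obtain ⟨n, hn, hnM, hn1⟩ := (hev.and (hM.and (eventually_ge_atTop 1))).exists
  rw [Measure.map_apply_of_aemeasurable (hclt.forall_aemeasurable n) measurableSet_Ioi] at hn
  have hsub : ((fun ω => (√(n : ℝ))⁻¹ * (∑ k ∈ Finset.range n, ξ k ω - n * ∫ ω, ξ 0 ω ∂P)) ⁻¹'
      Set.Ioi (1 : ℝ)) ⊆ {ω | ∃ n, M < ∑ i ∈ Finset.range n, ξ i ω} := by
    intro ω hω
    have hs : 0 < √(n : ℝ) := Real.sqrt_pos.2 (by exact_mod_cast hn1)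
    simp only [hmean, mul_zero, sub_zero, Set.mem_preimage, Set.mem_Ioi] at hω
    rw [inv_mul_eq_div, one_lt_div hs] at hω
    exact ⟨n, lt_of_le_of_lt hnM hω⟩
  have := hn.le.trans (measure_mono hsub)
  rw [measureReal_def]
  exact (ENNReal.toReal_mono (measure_ne_top _ _) this).trans_eq' (by simp)

/-- Discarding the first `m` steps does not affect whether the partial sums are bounded above, so
that boundedness is an event independent of the past up to any time. -/
theorem not_bddAbove_sum_shift_iff (x : ℕ → ℝ) (m : ℕ) :
    ¬ BddAbove (Set.range fun n => ∑ i ∈ Finset.range n, x (m + 1 + i)) ↔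
      ¬ BddAbove (Set.range fun n => ∑ i ∈ Finset.range n, x (1 + i)) := by
  rw [not_iff_not]
  induction m with
  | zero => simp
  | succ m ih =>
    have hidx : ∀ i, m + 1 + (i + 1) = m + 1 + 1 + i := fun i => by ring
    rw [← ih]
    constructor
    · rintro ⟨M, hM⟩
      refine ⟨max 0 (x (m + 1) + M), ?_⟩
      rintro _ ⟨n, rfl⟩
      rcases n with _ | n
      · simp
      · refine le_max_of_le_right ?_
        have := hM ⟨n, rfl⟩
        simp only at this ⊢
        rw [Finset.sum_range_succ']
        rw [add_zero, Finset.sum_congr rfl fun i _ => congrArg x (hidx i)]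
        linarith
    · rintro ⟨M, hM⟩
      refine ⟨M - x (m + 1), ?_⟩
      rintro _ ⟨n, rfl⟩
      have := hM ⟨n + 1, rfl⟩
      simp only at this ⊢
      rw [Finset.sum_range_succ'] at this
      rw [add_zero, Finset.sum_congr rfl fun i _ => congrArg x (hidx i)] at this
      linarith

/-- A centred nondegenerate random walk is almost surely unbounded above. -/
theorem ae_not_bddAbove_sum (hX : ∀ i, Measurable (X i)) (hind : iIndepFun X P)
    (hid : ∀ i, IdentDistrib (X (i + 1)) (X 1) P P) (hL2 : MemLp (X 1) 2 P)
    (hmean : ∫ ω, X 1 ω ∂P = 0) (hvar : variance (X 1) P ≠ 0) :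
    ∀ᵐ ω ∂P, ∀ m, ¬ BddAbove (Set.range fun n => ∑ i ∈ Finset.range n, X (m + 1 + i) ω) := by
  set U : Set Ω := {ω | ¬ BddAbove (Set.range fun n => ∑ i ∈ Finset.range n, X (1 + i) ω)} with hU
  have hUeq : ∀ m, U = {ω | ¬ BddAbove
      (Set.range fun n => ∑ i ∈ Finset.range n, X (m + 1 + i) ω)} := fun m =>
    Set.ext fun ω => (not_bddAbove_sum_shift_iff (fun i => X i ω) m).symm
  have hmeas : ∀ m, MeasurableSet[sigmaOf X (Set.Ioi m)] U := by
    intro m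
    rw [hUeq m]
    refine MeasurableSet.compl (measurableSet_bddAbove_range fun n => ?_)
    exact Finset.measurable_sum _ fun i _ =>
      measurable_sigmaOf (Set.mem_Ioi.2 (by omega))
  have hU0 : MeasurableSet U := sigmaOf_le hX _ _ (hmeas 0)
  obtain ⟨q, hq, hqM⟩ := exists_pos_le_measureReal_exists_lt_sum (ξ := fun i => X (i + 1))
    (hind.precomp (add_left_injective 1)) hid hL2 hmean hvar
  have hqU : q ≤ P.real U := by
    have hUi : U = ⋂ M : ℕ, {ω | ∃ n, (M : ℝ) < ∑ i ∈ Finset.range n, X (i + 1) ω} := by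
      ext ω
      simp only [hU, Set.mem_ofPred_eq, not_bddAbove_iff, Set.mem_range, exists_exists_eq_and,
        Set.mem_iInter, add_comm 1]
      refine ⟨fun h M => h M, fun h x => ?_⟩
      obtain ⟨M, hM⟩ := exists_nat_ge x
      obtain ⟨n, hn⟩ := h M
      exact ⟨n, hM.trans_lt hn⟩
    have hanti : Antitone fun M : ℕ =>
        {ω | ∃ n, (M : ℝ) < ∑ i ∈ Finset.range n, X (i + 1) ω} := by
      rintro M M' hMM ω ⟨n, hn⟩
      exact ⟨n, lt_of_le_of_lt (by exact_mod_cast hMM) hn⟩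
    have hms : ∀ M : ℕ, NullMeasurableSet
        {ω | ∃ n, (M : ℝ) < ∑ i ∈ Finset.range n, X (i + 1) ω} P := by
      intro M
      simp only [Set.ofPred_exists]
      refine (MeasurableSet.iUnion fun n => ?_).nullMeasurableSet
      exact measurableSet_lt measurable_const (Finset.measurable_sum _ fun i _ => hX _)
    have ht := tendsto_measure_iInter_atTop hms hanti ⟨0, measure_ne_top P _⟩
    rw [← hUi] at ht
    exact ge_of_tendsto' ((ENNReal.tendsto_toReal (measure_ne_top _ _)).comp ht) fun M => hqM M
  have hlevy := ae_mem_of_frequently (P := P) (past X hX) (E := U) (D := fun _ => Set.univ)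
    (sigmaOf_le_iSup_past hX _ _ (hmeas 0)) (fun _ => MeasurableSet.univ) hq (by
      intro n A hA _
      rw [measureReal_inter_eq_mul hX hind
        (Set.disjoint_left.2 fun i (hi : i ≤ n) (hi' : n < i) => by omega) hA (hmeas n), mul_comm]
      exact mul_le_mul_of_nonneg_left hqU measureReal_nonneg)
  filter_upwards [hlevy] with ω hω m
  have : ω ∈ U := hω (Frequently.of_forall fun _ => Set.mem_univ _)
  rw [hUeq m] at this
  exact this

end RandomWalk

/-! ### Deterministic properties of a single path -/

/-- The sequence `y` follows the two-regime recursion with zero intercepts, slopes `α` and `β`,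
threshold `r` and innovations `x 1, x 2, …`. -/
def IsPath (α β r : ℝ) (y x : ℕ → ℝ) : Prop :=
  ∀ t, y (t + 1) = (if r < y t then α else β) * y t + x (t + 1)

section Path

variable {α β r : ℝ} {y x : ℕ → ℝ}

theorem IsPath.of_lt (h : IsPath α β r y x) {t : ℕ} (ht : r < y t) :
    y (t + 1) = α * y t + x (t + 1) := by
  rw [h t, if_pos ht]

theorem IsPath.of_le (h : IsPath α β r y x) {t : ℕ} (ht : y t ≤ r) :
    y (t + 1) = β * y t + x (t + 1) := by
  rw [h t, if_neg (not_lt.2 ht)]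

/-- As long as the path stays above the threshold, it is an explosive linear autoregression. -/
theorem IsPath.eq_pow_mul (h : IsPath α β r y x) (hα : α ≠ 0) (t J : ℕ)
    (habove : ∀ i < J, r < y (t + i)) :
    y (t + J) = α ^ J * (y t + ∑ j ∈ Finset.range J, α⁻¹ ^ (j + 1) * x (t + 1 + j)) := by
  induction J with
  | zero => simp
  | succ J ih =>
    have e := h.of_lt (habove J (Nat.lt_succ_self J))
    rw [← add_assoc, e, ih fun i hi => habove i (hi.trans (Nat.lt_succ_self J)),
      Finset.sum_range_succ, add_right_comm t J 1, inv_pow, pow_succ]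
    field_simp
    ring

/-- From a level `L`, noise whose total discounted size is at most `L / 2` cannot bring the path
back to the threshold. -/
theorem IsPath.lt_add (h : IsPath α β r y x) (hα : 1 < α) {L : ℝ} (hL : 2 * |r| ≤ L) {t : ℕ}
    (ht : L < y t)
    (hx : ∀ J, ∑ j ∈ Finset.range J, α⁻¹ ^ (j + 1) * |x (t + 1 + j)| ≤ L / 2) (J : ℕ) :
    r < y (t + J) := by
  induction J using Nat.strong_induction_on with
  | _ J ih =>
    have hα0 : 0 < α := one_pos.trans hα
    rw [h.eq_pow_mul hα0.ne' t J ih]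
    have h1 : -(L / 2) ≤ ∑ j ∈ Finset.range J, α⁻¹ ^ (j + 1) * x (t + 1 + j) := by
      refine (neg_le_neg (hx J)).trans ?_
      rw [← Finset.sum_neg_distrib]
      refine Finset.sum_le_sum fun j _ => ?_
      rw [← mul_neg]
      exact mul_le_mul_of_nonneg_left (neg_abs_le _) (by positivity)
    have h2 : L / 2 < y t + ∑ j ∈ Finset.range J, α⁻¹ ^ (j + 1) * x (t + 1 + j) := by linarith
    have h3 : (1 : ℝ) ≤ α ^ J := one_le_pow₀ hα.le
    have h4 : 0 ≤ L / 2 := by linarith [abs_nonneg r]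
    nlinarith [le_abs_self r]

theorem IsPath.add_le_succ (h : IsPath α β r y x) (hβ : β ≤ 1) {t : ℕ} (ht : y t ≤ min r 0) :
    y t + x (t + 1) ≤ y (t + 1) := by
  rw [h.of_le (ht.trans (min_le_left _ _))]
  nlinarith [ht.trans (min_le_right r 0)]

/-- Below `min r 0` the path dominates the random walk of the innovations, so an unbounded random
walk drives it above `min r 0` infinitely often. -/
theorem IsPath.frequently_lt (h : IsPath α β r y x) (hβ : β ≤ 1)
    (hx : ∀ m, ¬ BddAbove (Set.range fun n => ∑ i ∈ Finset.range n, x (m + 1 + i))) :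
    ∃ᶠ t in atTop, min r 0 < y t := by
  intro hev
  obtain ⟨T, hT⟩ := eventually_atTop.1 hev
  refine hx T ⟨min r 0 - y T, ?_⟩
  rintro _ ⟨n, rfl⟩
  have hdom : y T + ∑ i ∈ Finset.range n, x (T + 1 + i) ≤ y (T + n) := by
    induction n with
    | zero => simp
    | succ n ih =>
      have := h.add_le_succ hβ (not_lt.1 (hT (T + n) (Nat.le_add_right _ _)))
      rw [Finset.sum_range_succ, add_right_comm T 1 n]
      rw [← add_assoc T n 1]
      linarith
  have := not_lt.1 (hT (T + n) (Nat.le_add_right _ _))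
  simp only
  linarith

/-- With threshold zero, each innovation above `c > 0` raises a positive path by at least `c`. -/
theorem IsPath.lt_of_threshold_zero (h : IsPath α β 0 y x) (hα : 1 < α) {c : ℝ} (hc : 0 < c) {t : ℕ}
    (ht : 0 < y t) (k : ℕ) (hx : ∀ i < k, c < x (t + 1 + i)) : 0 < y (t + k) ∧ k * c ≤ y (t + k) := by
  induction k with
  | zero => simpa using ⟨ht, ht.le⟩
  | succ k ih =>
    obtain ⟨h0, h1⟩ := ih fun i hi => hx i (hi.trans (Nat.lt_succ_self k))
    have h2 := hx k (Nat.lt_succ_self k)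
    rw [add_right_comm] at h2
    rw [← add_assoc, h.of_lt h0]
    push_cast
    constructor <;> nlinarith

/-- From above `min r 0`, one innovation larger than `L + (α + |β|) * |r|` suffices to exceed
`L`. -/
theorem IsPath.lt_succ_of_lt (h : IsPath α β r y x) (hα : 0 < α) {L : ℝ} {t : ℕ}
    (ht : min r 0 < y t) (hx : L + (α + |β|) * |r| < x (t + 1)) : L < y (t + 1) := by
  have hβr : 0 ≤ |β| * |r| := by positivity
  have hαr : 0 ≤ α * |r| := by positivity
  rcases lt_or_ge r (y t) with hr | hr
  · rw [h.of_lt hr]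
    nlinarith [neg_abs_le r]
  · rw [h.of_le hr]
    have h0 : 0 < y t := by
      rcases min_lt_iff.1 ht with h' | h'
      · exact absurd h' (not_lt.2 hr)
      · exact h'
    have h1 : |β * y t| ≤ |β| * |r| := by
      rw [abs_mul, abs_of_pos h0]
      exact mul_le_mul_of_nonneg_left (hr.trans (le_abs_self r)) (abs_nonneg β)
    nlinarith [neg_abs_le (β * y t)]

/-- The negative part of the path grows by at most the size of the innovation and a constant. -/
theorem IsPath.neg_succ_le (h : IsPath α β r y x) (hα : 0 < α) (hβ : β ≤ 1) (t : ℕ) :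
    max (-y (t + 1)) 0 ≤ max (-y t) 0 + |x (t + 1)| + (α + |β|) * |r| := by
  have hβr : 0 ≤ |β| * |r| := by positivity
  have hαr : 0 ≤ α * |r| := by positivity
  have hN := le_max_left (-y t) 0
  have hN0 := le_max_right (-y t) 0
  have hx := neg_abs_le (x (t + 1))
  refine max_le ?_ (by nlinarith [abs_nonneg (x (t + 1))])
  rcases lt_or_ge r (y t) with hr | hr
  · rw [h.of_lt hr]
    nlinarith [neg_abs_le r]
  · rw [h.of_le hr]
    rcases le_or_gt (y t) 0 with h0 | h0
    · nlinarith
    · have h1 : |β * y t| ≤ |β| * |r| := by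
        rw [abs_mul, abs_of_pos h0]
        exact mul_le_mul_of_nonneg_left (hr.trans (le_abs_self r)) (abs_nonneg β)
      nlinarith [neg_abs_le (β * y t)]

theorem IsPath.abs_succ_le (h : IsPath α β r y x) (hα : 0 < α) (t : ℕ) :
    |y (t + 1)| ≤ α * |y t| + |β| * max (-y t) 0 + |x (t + 1)| + |β| * |r| := by
  have hβr : 0 ≤ |β| * |r| := by positivity
  have hβN : 0 ≤ |β| * max (-y t) 0 := by positivity
  have hαy : 0 ≤ α * |y t| := by positivity
  rcases lt_or_ge r (y t) with hr | hr
  · rw [h.of_lt hr]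
    refine (abs_add_le _ _).trans ?_
    rw [abs_mul, abs_of_pos hα]
    linarith
  · rw [h.of_le hr]
    refine (abs_add_le _ _).trans ?_
    rw [abs_mul]
    rcases le_or_gt (y t) 0 with h0 | h0
    · rw [max_eq_left (by linarith), abs_of_nonpos h0] at *
      linarith
    · have h1 : |β| * |y t| ≤ |β| * |r| := by
        rw [abs_of_pos h0]
        exact mul_le_mul_of_nonneg_left (hr.trans (le_abs_self r)) (abs_nonneg β)
      linarith

end Path

/-- An affine inhomogeneity does not change the geometric growth rate: adding a suitable affine
function of `n` to `a` yields a sequence that grows at most by the factor `α` in each step. -/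
theorem exists_le_mul_pow_of_succ_le {α B D : ℝ} (hα : 1 < α) (hB : 0 ≤ B) (hD : 0 ≤ D) {a : ℕ → ℝ}
    (h : ∀ n, a (n + 1) ≤ α * a n + (B + n * D)) : ∃ C, ∀ n, a n ≤ C * α ^ n := by
  have h1 : 0 < α - 1 := sub_pos.2 hα
  obtain ⟨p, hp0, hp⟩ : ∃ p : ℝ, 0 ≤ p ∧ α * p = D + p := ⟨D / (α - 1), by positivity, by
    field_simp; ring⟩
  obtain ⟨s, hs0, hs⟩ : ∃ s : ℝ, 0 ≤ s ∧ α * s = B + p + s := ⟨(B + p) / (α - 1), by positivity, by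
    field_simp; ring⟩
  refine ⟨a 0 + s, fun n => ?_⟩
  have key : ∀ n : ℕ, a n + (p * n + s) ≤ (a 0 + s) * α ^ n := by
    intro n
    induction n with
    | zero => simp
    | succ n ih =>
      have := h n
      have h2 := mul_le_mul_of_nonneg_left ih (one_pos.trans hα).le
      rw [pow_succ]
      push_cast
      have e : α * (a n + (p * n + s)) = α * a n + n * (α * p) + α * s := by ring
      rw [e, hp, hs] at h2
      linarith
  have := key n
  have : 0 ≤ p * n := by positivity
  linarith

/-! ### The weights of the limiting series -/

section Weights

variable {Ω : Type*} {α β r : ℝ} {Y ε : ℕ → Ω → ℝ} {ω : Ω}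

theorem visits_eq_zero {T k : ℕ} (hT : ∀ t, T ≤ t → r < Y t ω) (hk : T ≤ k) :
    visits r Y k ω = 0 := by
  rw [visits, Set.encard_eq_zero, Set.eq_empty_iff_forall_notMem]
  rintro t ⟨h1, h2⟩
  exact absurd (hT t (hk.trans h1)) (not_lt.2 h2)

theorem visits_lt_top {T : ℕ} (hT : ∀ t, T ≤ t → r < Y t ω) (k : ℕ) : visits r Y k ω < ⊤ := by
  refine Set.encard_lt_top_iff.2 ((Set.finite_Iio T).subset ?_)
  rintro t ⟨-, h⟩
  by_contra hc
  exact absurd (hT t (not_lt.1 hc)) (not_lt.2 h)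

theorem visits_eq_add (k : ℕ) :
    visits r Y k ω = visits r Y (k + 1) ω + (if r < Y k ω then 0 else 1) := by
  unfold visits
  split_ifs with h
  · rw [add_zero]
    congr 1
    ext t
    refine ⟨fun ⟨h1, h2⟩ => ⟨?_, h2⟩, fun ⟨h1, h2⟩ => ⟨by omega, h2⟩⟩
    rcases h1.eq_or_lt with rfl | h3
    · exact absurd h (not_lt.2 h2)
    · exact h3
  · rw [← Set.encard_insert_of_notMem (a := k) (fun hk => absurd hk.1 (by omega))]
    congr 1
    ext t
    simp only [Set.mem_insert_iff, Set.mem_ofPred_eq]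
    constructor
    · rintro ⟨h1, h2⟩
      rcases h1.eq_or_lt with rfl | h3
      · exact Or.inl rfl
      · exact Or.inr ⟨h3, h2⟩
    · rintro (rfl | ⟨h1, h2⟩)
      · exact ⟨le_rfl, not_lt.1 h⟩
      · exact ⟨by omega, h2⟩

theorem aboveProd_eq_one {T k : ℕ} (hT : ∀ t, T ≤ t → r < Y t ω) (hk : T ≤ k) :
    aboveProd r Y k ω = 1 := by
  rw [aboveProd, tprod_congr fun j => if_pos (hT (k + j) (by omega)), tprod_one]

theorem aboveProd_eq_mul {T : ℕ} (hT : ∀ t, T ≤ t → r < Y t ω) (k : ℕ) :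
    aboveProd r Y k ω = (if r < Y k ω then 1 else 0) * aboveProd r Y (k + 1) ω := by
  have hm : Multipliable fun j : ℕ => if r < Y (k + (j + 1)) ω then (1 : ℝ) else 0 := by
    refine multipliable_of_ne_finset_one (s := Finset.range T) fun j hj => ?_
    rw [Finset.mem_range, not_lt] at hj
    exact if_pos (hT _ (by omega))
  have h := tprod_eq_zero_mul' (f := fun j : ℕ => if r < Y (k + j) ω then (1 : ℝ) else 0) hm
  have h' : (∏' j : ℕ, if r < Y (k + (j + 1)) ω then (1 : ℝ) else 0) =
      aboveProd r Y (k + 1) ω :=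
    tprod_congr fun j => by rw [add_comm j 1, ← add_assoc]
  rw [h'] at h
  exact h

theorem weight_eq_inv_pow {T k : ℕ} (hT : ∀ t, T ≤ t → r < Y t ω) (hk : T ≤ k) :
    weight α β r Y k ω = α⁻¹ ^ k := by
  rw [weight, aboveProd_eq_one hT hk, visits_eq_zero hT hk]
  simp

/-- Passing from index `k + 1` to index `k` multiplies the weight by the slope that is active at
time `k`. -/
theorem weight_eq_mul (hα : α ≠ 0) {T : ℕ} (hT : ∀ t, T ≤ t → r < Y t ω) (k : ℕ) :
    weight α β r Y k ω = (if r < Y k ω then α else β) * weight α β r Y (k + 1) ω := by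
  unfold weight
  split_ifs with hβ h h
  · rw [aboveProd_eq_mul hT k, if_pos h, pow_succ]
    field_simp
  · rw [aboveProd_eq_mul hT k, if_neg h, hβ]
    simp
  · rw [visits_eq_add k, if_pos h, add_zero, pow_succ]
    field_simp
  · rw [visits_eq_add k, if_neg h, ENat.toNat_add (visits_lt_top hT _).ne (by simp)]
    simp only [ENat.toNat_one, pow_succ]
    field_simp

/-- The weights turn the recursion into a telescoping identity. -/
theorem sum_xiTerm_add (hα : α ≠ 0) {T : ℕ} (hT : ∀ t, T ≤ t → r < Y t ω)
    (hpath : IsPath α β r (fun t => Y t ω) fun t => ε t ω) (n : ℕ) :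
    ∑ j ∈ Finset.range n, xiTerm α β r Y ε j ω + weight α β r Y 0 ω * Y 0 ω =
      weight α β r Y n ω * Y n ω := by
  induction n with
  | zero => simp
  | succ n ih =>
    have h := hpath n
    simp only at h
    rw [Finset.sum_range_succ, add_right_comm, ih, h, weight_eq_mul hα hT n, xiTerm]
    ring

theorem summable_xiTerm {T : ℕ} (hT : ∀ t, T ≤ t → r < Y t ω)
    (hs : Summable fun j : ℕ => α⁻¹ ^ (j + 1) * |ε (j + 1) ω|) :
    Summable fun j => xiTerm α β r Y ε j ω := by
  refine (summable_nat_add_iff T).1 (Summable.of_norm ?_)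
  refine Summable.congr ((summable_nat_add_iff T).2 hs.norm) fun j => ?_
  rw [xiTerm, weight_eq_inv_pow hT (by omega), norm_mul, norm_mul]
  simp

theorem tendsto_div_pow_xi (hα : α ≠ 0) {T : ℕ} (hT : ∀ t, T ≤ t → r < Y t ω)
    (hpath : IsPath α β r (fun t => Y t ω) fun t => ε t ω)
    (hs : Summable fun j => xiTerm α β r Y ε j ω) :
    Tendsto (fun n => Y n ω / α ^ n) atTop (𝓝 (xi α β r Y ε ω)) := by
  refine (hs.hasSum.tendsto_sum_nat.add_const (weight α β r Y 0 ω * Y 0 ω)).congr' ?_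
  filter_upwards [eventually_ge_atTop T] with n hn
  rw [sum_xiTerm_add hα hT hpath, weight_eq_inv_pow hT hn, inv_pow, inv_mul_eq_div]

end Weights

section ThresholdProcess

variable {Ω : Type*} {α β r : ℝ} {X Y : ℕ → Ω → ℝ}

theorem measurable_sigmaOf_Iic (hY0 : ∀ ω, Y 0 ω = X 0 ω)
    (hpath : ∀ ω, IsPath α β r (fun t => Y t ω) fun t => X t ω) (n : ℕ) :
    Measurable[sigmaOf X (Set.Iic n)] (Y n) := by
  induction n with
  | zero =>
    rw [funext hY0]
    exact measurable_sigmaOf (Set.mem_Iic.2 le_rfl)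
  | succ n ih =>
    have ih' : Measurable[sigmaOf X (Set.Iic (n + 1))] (Y n) :=
      ih.mono (sigmaOf_mono (Set.Iic_subset_Iic.2 n.le_succ)) le_rfl
    have hx : Measurable[sigmaOf X (Set.Iic (n + 1))] (X (n + 1)) :=
      measurable_sigmaOf (Set.mem_Iic.2 le_rfl)
    have e : Y (n + 1) = fun ω => (if r < Y n ω then α else β) * Y n ω + X (n + 1) ω :=
      funext fun ω => hpath ω n
    rw [e]
    exact ((Measurable.ite (ih' measurableSet_Ioi) measurable_const measurable_const).mul ih').add hx

/-! ### The discounted size of the future noise -/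

/-- The discounted absolute size `∑_{j ≥ 1} α^{-j} |X (t + j)|` of the noise after time `t`, as an
extended nonnegative number. -/
noncomputable def futureNoise (α : ℝ) (X : ℕ → Ω → ℝ) (t : ℕ) (ω : Ω) : ENNReal :=
  ∑' j : ℕ, ENNReal.ofReal (α⁻¹ ^ (j + 1) * |X (t + 1 + j) ω|)

theorem measurable_futureNoise (t : ℕ) :
    Measurable[sigmaOf X (Set.Ioi t)] (futureNoise α X t) := by
  let _ : MeasurableSpace Ω := sigmaOf X (Set.Ioi t)
  refine Measurable.tsum fun j => ?_
  have h : Measurable[sigmaOf X (Set.Ioi t)] (X (t + 1 + j)) :=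
    measurable_sigmaOf (Set.mem_Ioi.2 (by omega))
  exact (measurable_const.mul (measurable_abs.comp h)).ennreal_ofReal

variable [MeasurableSpace Ω] {P : Measure Ω}

theorem exists_lintegral_futureNoise_le (hα : 1 < α) (hX : Integrable (X 1) P)
    (hid : ∀ i, IdentDistrib (X (i + 1)) (X 1) P P) :
    ∃ K : ℝ, 0 ≤ K ∧ ∀ t, ∫⁻ ω, futureNoise α X t ω ∂P ≤ ENNReal.ofReal K := by
  have hα0 : 0 < α := one_pos.trans hα
  have hm : ∀ n, ∫ ω, |X (n + 1) ω| ∂P = ∫ ω, |X 1 ω| ∂P := fun n =>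
    ((hid n).comp measurable_abs).integral_eq
  have hi : ∀ n, Integrable (fun ω => |X (n + 1) ω|) P := fun n =>
    ((hid n).integrable_iff.2 hX).abs
  have hm0 : 0 ≤ ∫ ω, |X 1 ω| ∂P := integral_nonneg fun ω => abs_nonneg _
  have hsum : Summable fun j : ℕ => α⁻¹ ^ (j + 1) * ∫ ω, |X 1 ω| ∂P :=
    ((summable_nat_add_iff 1).2 (summable_geometric_of_lt_one (by positivity)
      (inv_lt_one_of_one_lt₀ hα))).mul_right _
  refine ⟨∑' j : ℕ, α⁻¹ ^ (j + 1) * ∫ ω, |X 1 ω| ∂P, tsum_nonneg fun j => by positivity,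
    fun t => ?_⟩
  unfold futureNoise
  rw [lintegral_tsum, ENNReal.ofReal_tsum_of_nonneg (fun j => by positivity) hsum]
  · refine ENNReal.tsum_le_tsum fun j => ?_
    rw [add_right_comm t 1 j, ← ofReal_integral_eq_lintegral_ofReal ((hi _).const_mul _)
      (ae_of_all _ fun ω => by positivity), integral_const_mul, hm]
  · intro j
    rw [add_right_comm t 1 j]
    exact ((hi _).const_mul _).aestronglyMeasurable.aemeasurable.ennreal_ofReal

theorem ae_summable_noise (hα : 1 < α) (hX : Integrable (X 1) P) (hXm : ∀ i, Measurable (X i))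
    (hid : ∀ i, IdentDistrib (X (i + 1)) (X 1) P P) :
    ∀ᵐ ω ∂P, Summable fun j : ℕ => α⁻¹ ^ (j + 1) * |X (j + 1) ω| := by
  obtain ⟨K, -, hK⟩ := exists_lintegral_futureNoise_le hα hX hid
  have hV : Measurable (futureNoise α X 0) :=
    (measurable_futureNoise 0).mono (sigmaOf_le hXm _) le_rfl
  have hα0 : 0 < α := one_pos.trans hα
  filter_upwards [ae_lt_top hV ((hK 0).trans_lt ENNReal.ofReal_lt_top).ne] with ω hω
  refine (ENNReal.summable_toReal hω.ne).congr fun j => ?_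
  rw [ENNReal.toReal_ofReal (by positivity), zero_add, add_comm 1 j]

/-! ### Growth of the first absolute moment -/

theorem integrable_path (hX : ∀ i, Integrable (X i) P) (hXm : ∀ i, Measurable (X i))
    (hY0 : ∀ ω, Y 0 ω = X 0 ω)
    (hpath : ∀ ω, IsPath α β r (fun t => Y t ω) fun t => X t ω) (n : ℕ) : Integrable (Y n) P := by
  have hYm : ∀ n, Measurable (Y n) := fun n =>
    (measurable_sigmaOf_Iic hY0 hpath n).mono (sigmaOf_le hXm _) le_rfl
  induction n with
  | zero => rw [funext hY0]; exact hX 0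
  | succ n ih =>
    have e : Y (n + 1) = fun ω => (if r < Y n ω then α else β) * Y n ω + X (n + 1) ω :=
      funext fun ω => hpath ω n
    rw [e]
    refine Integrable.add (ih.bdd_mul (c := max |α| |β|) ?_ ?_) (hX (n + 1))
    · exact (Measurable.ite ((hYm n) measurableSet_Ioi) measurable_const
        measurable_const).aestronglyMeasurable
    · refine ae_of_all _ fun ω => ?_
      rw [Real.norm_eq_abs]
      split_ifs
      · exact le_max_left _ _
      · exact le_max_right _ _

variable [IsProbabilityMeasure P]

/-- The negative part of the process has an expectation of at most linear growth, and it is the only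
obstruction to the factor `α` in `𝔼|Y (n + 1)| ≤ α * 𝔼|Y n| + const`. -/
theorem integral_abs_isBigO (hα : 1 < α) (hβ : β ≤ 1) (hX : ∀ i, Integrable (X i) P)
    (hXm : ∀ i, Measurable (X i)) (hid : ∀ i, IdentDistrib (X (i + 1)) (X 1) P P)
    (hY0 : ∀ ω, Y 0 ω = X 0 ω) (hpath : ∀ ω, IsPath α β r (fun t => Y t ω) fun t => X t ω) :
    (fun n : ℕ => ∫ ω, |Y n ω| ∂P) =O[atTop] (fun n : ℕ => α ^ n) := by
  have hα0 : 0 < α := one_pos.trans hα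
  have hY := integrable_path hX hXm hY0 hpath
  have hN : ∀ n, Integrable (fun ω => max (-Y n ω) 0) P := fun n => (hY n).neg.pos_part
  have hm : ∀ n, ∫ ω, |X (n + 1) ω| ∂P = ∫ ω, |X 1 ω| ∂P := fun n =>
    ((hid n).comp measurable_abs).integral_eq
  set m := ∫ ω, |X 1 ω| ∂P
  have hm0 : 0 ≤ m := integral_nonneg fun ω => abs_nonneg _
  set C := (α + |β|) * |r| with hC
  have hC0 : 0 ≤ C := by positivity
  have hneg : ∀ n : ℕ, ∫ ω, max (-Y n ω) 0 ∂P ≤ ∫ ω, max (-Y 0 ω) 0 ∂P + n * (m + C) := by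
    intro n
    induction n with
    | zero => simp
    | succ n ih =>
      have hint : Integrable (fun ω => max (-Y n ω) 0 + |X (n + 1) ω|) P := (hN n).add (hX _).abs
      have h := integral_mono (hN (n + 1)) (hint.add (integrable_const C))
        (fun ω => (hpath ω).neg_succ_le hα0 hβ n)
      simp only [Pi.add_apply] at h
      rw [integral_add hint (integrable_const C), integral_add (hN n) (hX _).abs, hm] at h
      simp only [integral_const, probReal_univ, one_smul] at h
      push_cast
      linarith
  have hb0 : 0 ≤ ∫ ω, max (-Y 0 ω) 0 ∂P := integral_nonneg fun ω => le_max_right _ _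
  obtain ⟨K, hK⟩ := exists_le_mul_pow_of_succ_le (a := fun n => ∫ ω, |Y n ω| ∂P)
    (B := |β| * ∫ ω, max (-Y 0 ω) 0 ∂P + m + |β| * |r|) (D := |β| * (m + C)) hα
    (by positivity) (by positivity) (by
      intro n
      have hi1 : Integrable (fun ω => α * |Y n ω| + |β| * max (-Y n ω) 0) P :=
        ((hY n).abs.const_mul α).add ((hN n).const_mul |β|)
      have hi2 : Integrable (fun ω => α * |Y n ω| + |β| * max (-Y n ω) 0 + |X (n + 1) ω|) P :=
        hi1.add (hX _).abs
      have h := integral_mono (hY (n + 1)).abs (hi2.add (integrable_const (|β| * |r|)))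
        (fun ω => (hpath ω).abs_succ_le hα0 n)
      simp only [Pi.add_apply] at h
      rw [integral_add hi2 (integrable_const _), integral_add hi1 (hX _).abs,
        integral_add ((hY n).abs.const_mul α) ((hN n).const_mul |β|), integral_const_mul,
        integral_const_mul, hm] at h
      simp only [integral_const, probReal_univ, one_smul] at h
      have := mul_le_mul_of_nonneg_left (hneg n) (abs_nonneg β)
      linarith)
  refine IsBigO.of_bound K (Eventually.of_forall fun n => ?_)
  rw [Real.norm_of_nonneg (integral_nonneg fun ω => abs_nonneg _),
    Real.norm_of_nonneg (by positivity)]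
  exact hK n

/-! ### Eventual escape above the threshold -/

theorem half_le_measureReal_futureNoise_le (hXm : ∀ i, Measurable (X i)) {K L : ℝ} (hL : 0 < L)
    (hKL : 4 * K ≤ L) {t : ℕ} (hK : ∫⁻ ω, futureNoise α X t ω ∂P ≤ ENNReal.ofReal K) :
    1 / 2 ≤ P.real {ω | futureNoise α X t ω ≤ ENNReal.ofReal (L / 2)} := by
  have hV : Measurable (futureNoise α X t) :=
    (measurable_futureNoise t).mono (sigmaOf_le hXm _) le_rfl
  have hcompl : {ω | futureNoise α X t ω ≤ ENNReal.ofReal (L / 2)} =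
      {ω | ENNReal.ofReal (L / 2) < futureNoise α X t ω}ᶜ := by
    ext ω; simp
  rw [hcompl, probReal_compl_eq_one_sub (measurableSet_lt measurable_const hV)]
  have h1 : P {ω | ENNReal.ofReal (L / 2) < futureNoise α X t ω} ≤ ENNReal.ofReal (1 / 2) := by
    have hmk := meas_ge_le_lintegral_div (μ := P) hV.aemeasurable
      (ε := ENNReal.ofReal (L / 2)) (by simpa using hL) ENNReal.ofReal_ne_top
    refine (measure_mono (t := {ω | ENNReal.ofReal (L / 2) ≤ futureNoise α X t ω})
      fun ω h => le_of_lt (show ENNReal.ofReal (L / 2) < _ from h)).trans (hmk.trans ?_)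
    refine (ENNReal.div_le_div_right hK _).trans ?_
    rw [← ENNReal.ofReal_div_of_pos (by positivity)]
    refine ENNReal.ofReal_le_ofReal ?_
    rw [div_le_iff₀ (by positivity)]
    linarith
  have h2 := ENNReal.toReal_mono ENNReal.ofReal_ne_top h1
  rw [ENNReal.toReal_ofReal (by norm_num)] at h2
  rw [measureReal_def]
  linarith

/-- If some finite pattern of large innovations lifts every path from above `min r 0` to above any
prescribed level `L`, then almost surely the path is eventually above the threshold. -/
theorem ae_eventually_lt (hα : 1 < α) (hβ : β ≤ 1) (hL2 : MemLp (X 1) 2 P)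
    (hXm : ∀ i, Measurable (X i)) (hind : iIndepFun X P)
    (hid : ∀ i, IdentDistrib (X (i + 1)) (X 1) P P)
    (hmean : ∫ ω, X 1 ω ∂P = 0) (hvar : variance (X 1) P ≠ 0)
    (hY0 : ∀ ω, Y 0 ω = X 0 ω) (hpath : ∀ ω, IsPath α β r (fun t => Y t ω) fun t => X t ω)
    (hlift : ∀ L : ℝ, ∃ (k : ℕ) (c : ℝ), 0 < P.real {ω | c < X 1 ω} ∧
      ∀ s ω, min r 0 < Y s ω → (∀ i < k, c < X (s + 1 + i) ω) → L < Y (s + k) ω) :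
    ∀ᵐ ω ∂P, ∃ T, ∀ t, T ≤ t → r < Y t ω := by
  have hα0 : 0 < α := one_pos.trans hα
  obtain ⟨K, hK0, hK⟩ := exists_lintegral_futureNoise_le hα (hL2.integrable one_le_two) hid
  have hLpos : 0 < 4 * K + 2 * |r| + 1 := by positivity
  set L := 4 * K + 2 * |r| + 1 with hLdef
  obtain ⟨k, c, hp, hkc⟩ := hlift L
  set p := P.real {ω | c < X 1 ω} with hpdef
  have hYm := measurable_sigmaOf_Iic hY0 hpath
  have hYsup : ∀ t, Measurable[⨆ n, past X hXm n] (Y t) := fun t =>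
    (hYm t).mono (sigmaOf_le_iSup_past hXm _) le_rfl
  let E : Set Ω := {ω | ∃ T, ∀ t, T ≤ t → r < Y t ω}
  have hE : MeasurableSet[⨆ n, past X hXm n] E := by
    have : E = ⋃ T, ⋂ t, ⋂ (_ : T ≤ t), {ω | r < Y t ω} := by
      ext ω; simp [E]
    rw [this]
    exact MeasurableSet.iUnion fun T => MeasurableSet.iInter fun t => MeasurableSet.iInter fun _ =>
      hYsup t measurableSet_Ioi
  -- the innovations after time `s` that lead to an escape from any state above `min r 0`
  let B : ℕ → Set Ω := fun s => ⋂ i ∈ Finset.Ioc s (s + k), X i ⁻¹' Set.Ioi c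
  let H : ℕ → Set Ω := fun s => {ω | futureNoise α X (s + k) ω ≤ ENNReal.ofReal (L / 2)}
  have hBm : ∀ s, MeasurableSet[sigmaOf X (Set.Ioc s (s + k))] (B s) := fun s =>
    Finset.measurableSet_biInter _ fun i hi =>
      measurable_sigmaOf (Finset.mem_Ioc.1 hi) measurableSet_Ioi
  have hHm : ∀ s, MeasurableSet[sigmaOf X (Set.Ioi (s + k))] (H s) := fun s =>
    measurable_futureNoise (s + k) measurableSet_Iic
  have hBHm : ∀ s, MeasurableSet[sigmaOf X (Set.Ioi s)] (B s ∩ H s) := fun s =>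
    (sigmaOf_mono Set.Ioc_subset_Ioi_self _ (hBm s)).inter
      (sigmaOf_mono (Set.Ioi_subset_Ioi (Nat.le_add_right s k)) _ (hHm s))
  have hBp : ∀ s, P.real (B s) = p ^ k := by
    intro s
    have h := hind.measure_inter_preimage_eq_mul (Finset.Ioc s (s + k))
      (sets := fun _ => Set.Ioi c) fun _ _ => measurableSet_Ioi
    have hone : ∀ i ∈ Finset.Ioc s (s + k), P (X i ⁻¹' Set.Ioi c) = P {ω | c < X 1 ω} := by
      intro i hi
      obtain ⟨j, rfl⟩ := Nat.exists_eq_succ_of_ne_zero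
        (Nat.ne_of_gt (lt_of_le_of_lt (Nat.zero_le s) (Finset.mem_Ioc.1 hi).1))
      exact (hid j).measure_mem_eq measurableSet_Ioi
    rw [Finset.prod_congr rfl hone, Finset.prod_const, Nat.card_Ioc, Nat.add_sub_cancel_left] at h
    rw [measureReal_def, h, ENNReal.toReal_pow]
    rfl
  have hq : ∀ s, p ^ k * (1 / 2) ≤ P.real (B s ∩ H s) := by
    intro s
    have hdisj : Disjoint (Set.Ioc s (s + k)) (Set.Ioi (s + k)) :=
      Set.disjoint_left.2 fun i hi hi' => absurd hi.2 (not_le.2 hi')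
    have hmul := measureReal_inter_eq_mul (P := P) hXm hind hdisj (hBm s) (hHm s)
    rw [hmul, hBp s]
    refine mul_le_mul_of_nonneg_left ?_ (by positivity)
    exact half_le_measureReal_futureNoise_le hXm hLpos (by linarith [abs_nonneg r]) (hK _)
  have hesc : ∀ s, {ω | min r 0 < Y s ω} ∩ (B s ∩ H s) ⊆ E := by
    rintro s ω ⟨hs, hB, hH⟩
    have hlev := hkc s ω hs fun i hi => by
      have := Set.mem_iInter₂.1 hB (s + 1 + i) (Finset.mem_Ioc.2 ⟨by omega, by omega⟩)
      exact this
    refine ⟨s + k, fun t ht => ?_⟩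
    obtain ⟨J, rfl⟩ := Nat.exists_eq_add_of_le ht
    refine (hpath ω).lt_add hα (L := L) (by linarith) hlev (fun J => ?_) J
    have h1 := (ENNReal.sum_le_tsum (f := fun j : ℕ => ENNReal.ofReal
      (α⁻¹ ^ (j + 1) * |X (s + k + 1 + j) ω|)) (Finset.range J)).trans hH
    rw [← ENNReal.ofReal_sum_of_nonneg fun j _ => by positivity] at h1
    exact (ENNReal.ofReal_le_ofReal_iff (by positivity)).1 h1
  have hlevy := ae_mem_of_frequently (P := P) (past X hXm) hE
    (D := fun s => {ω | min r 0 < Y s ω}) (fun s => hYm s measurableSet_Ioi)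
    (q := p ^ k * (1 / 2)) (by positivity) (by
      intro s A hA hAD
      have h1 := measureReal_inter_eq_mul (P := P) hXm hind (Set.disjoint_left.2
        fun i (hi : i ≤ s) (hi' : s < i) => by omega) hA (hBHm s)
      have h2 : P.real (A ∩ (B s ∩ H s)) ≤ P.real (A ∩ E) :=
        measureReal_mono fun ω hω => ⟨hω.1, hesc s ⟨hAD hω.1, hω.2⟩⟩
      have h3 := mul_le_mul_of_nonneg_left (hq s) (measureReal_nonneg (μ := P) (s := A))
      linarith)
  filter_upwards [hlevy, ae_not_bddAbove_sum hXm hind hid hL2 hmean hvar] with ω h1 h2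
  exact h1 ((hpath ω).frequently_lt hβ h2)

/-! ### Nondegeneracy of the limit -/

theorem measureReal_pos_lt_pos_of_mean_zero {ξ : Ω → ℝ} (hξ : Integrable ξ P)
    (hmean : ∫ ω, ξ ω ∂P = 0) (hvar : variance ξ P ≠ 0) : 0 < P.real {ω | 0 < ξ ω} := by
  refine lt_of_le_of_ne measureReal_nonneg fun h0 => hvar ?_
  have hle : ∀ᵐ ω ∂P, ξ ω ≤ 0 := by
    rw [ae_iff]
    simpa only [not_le] using (measureReal_eq_zero_iff (measure_ne_top P _)).1 h0.symm
  have hz : (fun ω => -ξ ω) =ᵐ[P] 0 := by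
    refine (integral_eq_zero_iff_of_nonneg_ae ?_ hξ.neg).1 ?_
    · filter_upwards [hle] with ω h
      simpa using h
    · simp [integral_neg, hmean]
  have hz' : ξ =ᵐ[P] 0 := by
    filter_upwards [hz] with ω h
    simpa using h
  rw [variance_congr hz', variance_zero]

/-- Almost surely the normalised path does not tend to zero while staying above the threshold. At
any time `n ≥ S` these two requirements pin down the next innovation in terms of all the others,
and it misses the prescribed value with probability bounded below given the past. -/
theorem ae_not_tendsto_zero (hα : 1 < α) (hL2 : MemLp (X 1) 2 P)
    (hXm : ∀ i, Measurable (X i)) (hind : iIndepFun X P)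
    (hid : ∀ i, IdentDistrib (X (i + 1)) (X 1) P P)
    (hmean : ∫ ω, X 1 ω ∂P = 0) (hvar : variance (X 1) P ≠ 0)
    (hY0 : ∀ ω, Y 0 ω = X 0 ω) (hpath : ∀ ω, IsPath α β r (fun t => Y t ω) fun t => X t ω)
    (S : ℕ) :
    ∀ᵐ ω ∂P, (∀ t, S ≤ t → r < Y t ω) → ¬ Tendsto (fun n => Y n ω / α ^ n) atTop (𝓝 0) := by
  have hα0 : 0 < α := one_pos.trans hα
  have hint := hL2.integrable one_le_two
  have hpos := measureReal_pos_lt_pos_of_mean_zero hint hmean hvar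
  have hneg : 0 < P.real {ω | X 1 ω < 0} := by
    have := measureReal_pos_lt_pos_of_mean_zero (P := P) (ξ := fun ω => -X 1 ω) hint.neg
      (by simp [integral_neg, hmean]) (by rwa [variance_fun_neg])
    simpa using this
  set q := min (P.real {ω | 0 < X 1 ω}) (P.real {ω | X 1 ω < 0}) with hqdef
  have hq : 0 < q := lt_min hpos hneg
  have hYm := measurable_sigmaOf_Iic hY0 hpath
  have hYsup : ∀ t, Measurable[⨆ n, past X hXm n] (Y t) := fun t =>
    (hYm t).mono (sigmaOf_le_iSup_past hXm _) le_rfl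
  let N : Set Ω := {ω | (∀ t, S ≤ t → r < Y t ω) ∧ Tendsto (fun n => Y n ω / α ^ n) atTop (𝓝 0)}
  have hN : MeasurableSet[⨆ n, past X hXm n] N := by
    have : N = (⋂ t, ⋂ (_ : S ≤ t), {ω | r < Y t ω}) ∩
        {ω | Tendsto (fun n => Y n ω / α ^ n) atTop (𝓝 0)} := by
      ext ω; simp [N]
    rw [this]
    refine MeasurableSet.inter (MeasurableSet.iInter fun t => MeasurableSet.iInter fun _ =>
      hYsup t measurableSet_Ioi) ?_
    exact measurableSet_tendsto _ fun n => (hYsup n).div_const _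
  -- the discounted noise after time `n + 1`; the upper limit makes it measurable everywhere
  let W : ℕ → Ω → ℝ := fun n ω => limsup (fun J : ℕ =>
    ∑ j ∈ Finset.range J, α⁻¹ ^ (j + 1) * X (n + 1 + 1 + j) ω) atTop
  have hW : ∀ n, Measurable[sigmaOf X {n + 1}ᶜ] (W n) := fun n =>
    Measurable.limsup fun J => Finset.measurable_sum _ fun j _ =>
      measurable_const.mul (measurable_sigmaOf (by simp; omega))
  have hZ : ∀ n, Measurable[sigmaOf X {n + 1}ᶜ] fun ω => -(α * Y n ω) - W n ω := fun n =>
    (((hYm n).mono (sigmaOf_mono fun i (hi : i ≤ n) => by simp; omega) le_rfl).const_mul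
      α).neg.sub (hW n)
  have hNZ : ∀ n, S ≤ n → N ⊆ {ω | X (n + 1) ω = -(α * Y n ω) - W n ω} := by
    rintro n hn ω ⟨habove, hlim⟩
    have e1 := (hpath ω).of_lt (habove n hn)
    have hJ : ∀ J, Y (n + 1 + J) ω / α ^ (n + 1 + J) * α ^ (n + 1) - Y (n + 1) ω =
        ∑ j ∈ Finset.range J, α⁻¹ ^ (j + 1) * X (n + 1 + 1 + j) ω := by
      intro J
      have h := (hpath ω).eq_pow_mul hα0.ne' (n + 1) J fun i _ => habove _ (by omega)
      rw [h, pow_add]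
      field_simp
      ring
    have hshift : Tendsto (fun J => Y (n + 1 + J) ω / α ^ (n + 1 + J)) atTop (𝓝 0) := by
      simpa only [add_comm _ (n + 1)] using (tendsto_add_atTop_iff_nat (n + 1)).2 hlim
    have ht : Tendsto (fun J : ℕ => ∑ j ∈ Finset.range J, α⁻¹ ^ (j + 1) * X (n + 1 + 1 + j) ω)
        atTop (𝓝 (0 * α ^ (n + 1) - Y (n + 1) ω)) :=
      ((hshift.mul_const _).sub_const _).congr hJ
    have hWeq : W n ω = 0 * α ^ (n + 1) - Y (n + 1) ω := ht.limsup_eq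
    rw [Set.mem_ofPred_eq, hWeq, e1]
    ring
  have hlevy := ae_mem_of_frequently (P := P) (past X hXm) hN.compl
    (D := fun n => {_ω | S ≤ n}) (fun n => MeasurableSet.const _) hq (by
      intro n A hA hAD
      rcases A.eq_empty_or_nonempty with rfl | ⟨ω₀, hω₀⟩
      · simp
      have hn : S ≤ n := hAD hω₀
      have h1 : P.real {ω | 0 < X (n + 1) ω} = P.real {ω | 0 < X 1 ω} :=
        congrArg ENNReal.toReal ((hid n).measure_mem_eq measurableSet_Ioi)
      have h2 : P.real {ω | X (n + 1) ω < 0} = P.real {ω | X 1 ω < 0} :=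
        congrArg ENNReal.toReal ((hid n).measure_mem_eq measurableSet_Iio)
      refine (mul_measureReal_le_inter_ne hXm hind (n + 1) (h1 ▸ min_le_left _ _)
        (h2 ▸ min_le_right _ _) (hZ n)
        (sigmaOf_mono (fun i (hi : i ≤ n) => by simp; omega) _ hA)).trans ?_
      exact measureReal_mono fun ω hω => ⟨hω.1, fun hωN => hω.2 (hNZ n hn hωN)⟩)
  filter_upwards [hlevy] with ω h habove hlim
  exact h ((eventually_ge_atTop S).frequently) ⟨habove, hlim⟩

end ThresholdProcess

/-! ### The threshold process as a path driven by one independent sequence -/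

section Driver

variable {Ω : Type*}

/-- The initial value followed by the innovations `ε 1, ε 2, …`, as a single sequence. -/
def driver (Y₀ : Ω → ℝ) (ε : ℕ → Ω → ℝ) : ℕ → Ω → ℝ
  | 0 => Y₀
  | t + 1 => ε (t + 1)

theorem isPath_tar (α β r : ℝ) (Y₀ : Ω → ℝ) (ε : ℕ → Ω → ℝ) (ω : Ω) :
    IsPath α β r (fun t => tar 0 0 α β r Y₀ ε t ω) fun t => ε t ω := by
  intro t
  simp only [tar]
  split_ifs <;> ring

variable [MeasurableSpace Ω] {P : Measure Ω} {Y₀ : Ω → ℝ} {ε : ℕ → Ω → ℝ}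

theorem iIndepFun_driver (hε : iIndepFun (fun t => ε (t + 1)) P)
    (hY₀ : IndepFun Y₀ (fun ω (t : ℕ) => ε (t + 1) ω) P) : iIndepFun (driver Y₀ ε) P := by
  rw [iIndepFun_iff_measure_inter_preimage_eq_mul]
  intro S sets hsets
  set T : Finset ℕ := S.preimage (· + 1) (add_left_injective 1).injOn with hT
  have hmemT : ∀ j, j ∈ T ↔ j + 1 ∈ S := fun j => by simp [hT]
  have hTm : ∀ j ∈ T, MeasurableSet (sets (j + 1)) := fun j hj => hsets _ ((hmemT j).1 hj)
  have htail := hε.measure_inter_preimage_eq_mul T (sets := fun j => sets (j + 1)) hTm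
  have herase : S.erase 0 = T.image (· + 1) := by
    ext i
    rcases i with _ | i
    · simp
    · simp [hmemT]
  have hprod : ∏ i ∈ S.erase 0, P (driver Y₀ ε i ⁻¹' sets i) =
      P (⋂ j ∈ T, ε (j + 1) ⁻¹' sets (j + 1)) := by
    rw [herase, Finset.prod_image (add_left_injective 1).injOn, htail]
    rfl
  by_cases h0 : 0 ∈ S
  · rw [← Finset.mul_prod_erase S _ h0, hprod]
    have hB : MeasurableSet {x : ℕ → ℝ | ∀ j ∈ T, x j ∈ sets (j + 1)} := by
      have : {x : ℕ → ℝ | ∀ j ∈ T, x j ∈ sets (j + 1)} =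
          ⋂ j ∈ T, (fun x : ℕ → ℝ => x j) ⁻¹' sets (j + 1) := by ext; simp
      rw [this]
      exact Finset.measurableSet_biInter _ fun j hj => measurable_pi_apply j (hTm j hj)
    have h := hY₀.measure_inter_preimage_eq_mul _ _ (hsets 0 h0) hB
    convert! h using 2
    · ext ω
      simp only [Set.mem_iInter, Set.mem_preimage, Set.mem_inter_iff, Set.mem_ofPred_eq, hmemT]
      refine ⟨fun h => ⟨h 0 h0, fun j hj => h (j + 1) hj⟩, fun h i hi => ?_⟩
      rcases i with _ | i
      · exact h.1
      · exact h.2 i hi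
    · congr 1
      ext ω
      simp
  · rw [← Finset.erase_eq_of_notMem h0, hprod, Finset.erase_eq_of_notMem h0]
    congr 1
    ext ω
    simp only [Set.mem_iInter, Set.mem_preimage, hmemT]
    refine ⟨fun h j hj => h (j + 1) hj, fun h i hi => ?_⟩
    rcases i with _ | i
    · exact absurd hi h0
    · exact h i hi

variable [IsProbabilityMeasure P]

/-- With threshold zero, finitely many innovations above a small positive constant lift a positive
path above any level; with unbounded innovations a single large one does. -/
theorem exists_lift {α β r : ℝ} {X Y : ℕ → Ω → ℝ} (hX : Measurable (X 1))
    (hH : 1 < α ∧ (r = 0 ∧ 0 < P.real {ω | 0 < X 1 ω} ∨ ∀ x : ℝ, P {ω | X 1 ω ≤ x} < 1))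
    (hpath : ∀ ω, IsPath α β r (fun t => Y t ω) fun t => X t ω) (L : ℝ) :
    ∃ (k : ℕ) (c : ℝ), 0 < P.real {ω | c < X 1 ω} ∧
      ∀ s ω, min r 0 < Y s ω → (∀ i < k, c < X (s + 1 + i) ω) → L < Y (s + k) ω := by
  obtain ⟨hα, ⟨rfl, hpos⟩ | hunb⟩ := hH
  · obtain ⟨c, hc, hpc⟩ : ∃ c : ℝ, 0 < c ∧ 0 < P.real {ω | c < X 1 ω} := by
      by_contra! hcon
      have hun : {ω | 0 < X 1 ω} = ⋃ n : ℕ, {ω | 1 / ((n : ℝ) + 1) < X 1 ω} := by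
        ext ω
        simp only [Set.mem_ofPred_eq, Set.mem_iUnion]
        exact ⟨fun h => exists_nat_one_div_lt h, fun ⟨n, hn⟩ =>
          (Nat.one_div_pos_of_nat (n := n)).trans hn⟩
      have hz : P {ω | 0 < X 1 ω} = 0 := by
        rw [hun, measure_iUnion_null_iff]
        intro n
        exact (measureReal_eq_zero_iff (measure_ne_top P _)).1
          (le_antisymm (hcon _ Nat.one_div_pos_of_nat) measureReal_nonneg)
      rw [measureReal_def, hz] at hpos
      simp at hpos
    obtain ⟨k, hk⟩ := exists_nat_gt (L / c)
    refine ⟨k, c, hpc, fun s ω hs hx => ?_⟩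
    rw [min_self] at hs
    exact ((div_lt_iff₀ hc).1 hk).trans_le ((hpath ω).lt_of_threshold_zero hα hc hs k hx).2
  · refine ⟨1, L + (α + |β|) * |r|, ?_, fun s ω hs hx =>
      (hpath ω).lt_succ_of_lt (one_pos.trans hα) hs (hx 0 one_pos)⟩
    set x := L + (α + |β|) * |r|
    have hcompl : {ω | x < X 1 ω} = {ω | X 1 ω ≤ x}ᶜ := by ext ω; simp
    rw [hcompl, probReal_compl_eq_one_sub (measurableSet_le hX measurable_const), sub_pos]
    have := (ENNReal.toReal_lt_toReal (measure_ne_top P _) ENNReal.one_ne_top).2 (hunb x)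
    simpa [measureReal_def] using this

end Driver

end ThresholdAR

theorem theorem4p1 {Ω : Type*} [MeasurableSpace Ω] (P : Measure Ω) [IsProbabilityMeasure P]
    (γ δ α β r σ : ℝ) (Y₀ : Ω → ℝ) (ε : ℕ → Ω → ℝ)
    (hstd : ThresholdAR.StandingAssumptions P σ Y₀ ε)
    (hγ : γ = 0) (hδ : δ = 0)
    (hH : ThresholdAR.H1 P α β r Y₀ ∨ ThresholdAR.H2 P α β r Y₀ ε)
    (Y : ℕ → Ω → ℝ) (hY : Y = ThresholdAR.tar γ δ α β r Y₀ ε) :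
    ((∀ n, Integrable (Y n) P) ∧
      (fun n : ℕ => ∫ ω, |Y n ω| ∂P) =O[atTop] (fun n : ℕ => α ^ n)) ∧
    (∀ᵐ ω ∂P, ThresholdAR.visits r Y 0 ω < ⊤) ∧
    (∀ᵐ ω ∂P, Summable (fun j : ℕ => ThresholdAR.xiTerm α β r Y ε j ω)) ∧
    (∀ᵐ ω ∂P, Tendsto (fun n : ℕ => Y n ω / α ^ n) atTop
      (𝓝 (ThresholdAR.xi α β r Y ε ω))) ∧
    (∀ᵐ ω ∂P, 0 < ThresholdAR.xi α β r Y ε ω) := by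
  subst hγ hδ hY
  obtain ⟨hα, hβ, hY₀2, hcase⟩ : 1 < α ∧ β ≤ 1 ∧ Integrable (fun ω => Y₀ ω ^ 2) P ∧
      (r = 0 ∨ ∀ x : ℝ, P {ω | ε 1 ω ≤ x} < 1) := by
    rcases hH with ⟨h1, h2, h3, h4⟩ | ⟨h1, h2, -, h4, h5⟩
    · exact ⟨h1, h2, h4, Or.inl h3⟩
    · exact ⟨h1, h2, h4, Or.inr h5⟩
  set Y := ThresholdAR.tar 0 0 α β r Y₀ ε with hYdef
  set X := ThresholdAR.driver Y₀ ε with hXdef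
  have hα0 : α ≠ 0 := (one_pos.trans hα).ne'
  have hXm : ∀ i, Measurable (X i) := by
    rintro (_ | i)
    · exact hstd.measurable_init
    · exact hstd.measurable_noise (i + 1) (Nat.le_add_left 1 i)
  have hind : iIndepFun X P := ThresholdAR.iIndepFun_driver hstd.iIndep_noise hstd.indep_init
  have hid : ∀ i, IdentDistrib (X (i + 1)) (X 1) P P := fun i =>
    hstd.identDistrib_noise (i + 1) (Nat.le_add_left 1 i)
  have hL2 : MemLp (X 1) 2 P := hstd.memLp_noise
  have hint1 : Integrable (X 1) P := hL2.integrable one_le_two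
  have hmean : ∫ ω, X 1 ω ∂P = 0 := hstd.mean_noise
  have hvar : variance (X 1) P ≠ 0 :=
    hstd.variance_noise.trans_ne (pow_pos hstd.variance_pos 2).ne'
  have hXint : ∀ i, Integrable (X i) P := by
    rintro (_ | i)
    · exact ((memLp_two_iff_integrable_sq hstd.measurable_init.aestronglyMeasurable).2
        hY₀2).integrable one_le_two
    · exact (hid i).integrable_iff.2 hint1
  have hY0 : ∀ ω, Y 0 ω = X 0 ω := fun ω => rfl
  have hpathε : ∀ ω, ThresholdAR.IsPath α β r (fun t => Y t ω) fun t => ε t ω :=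
    ThresholdAR.isPath_tar α β r Y₀ ε
  have hpath : ∀ ω, ThresholdAR.IsPath α β r (fun t => Y t ω) fun t => X t ω := hpathε
  have hesc := ThresholdAR.ae_eventually_lt hα hβ hL2 hXm hind hid hmean hvar hY0 hpath
    (ThresholdAR.exists_lift (hXm 1) ⟨hα, hcase.imp_left fun h =>
      ⟨h, ThresholdAR.measureReal_pos_lt_pos_of_mean_zero hint1 hmean hvar⟩⟩ hpath)
  have hsum : ∀ᵐ ω ∂P, Summable fun j : ℕ => ThresholdAR.xiTerm α β r Y ε j ω := by
    filter_upwards [hesc, ThresholdAR.ae_summable_noise hα hint1 hXm hid] with ω ⟨T, hT⟩ hs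
    exact ThresholdAR.summable_xiTerm hT hs
  have hlim : ∀ᵐ ω ∂P, Tendsto (fun n : ℕ => Y n ω / α ^ n) atTop
      (𝓝 (ThresholdAR.xi α β r Y ε ω)) := by
    filter_upwards [hesc, hsum] with ω ⟨T, hT⟩ hs
    exact ThresholdAR.tendsto_div_pow_xi hα0 hT (hpathε ω) hs
  refine ⟨⟨ThresholdAR.integrable_path hXint hXm hY0 hpath,
    ThresholdAR.integral_abs_isBigO hα hβ hXint hXm hid hY0 hpath⟩, ?_, hsum, hlim, ?_⟩
  · filter_upwards [hesc] with ω ⟨T, hT⟩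
    exact ThresholdAR.visits_lt_top hT 0
  · filter_upwards [hesc, hlim, ae_all_iff.2 fun S => ThresholdAR.ae_not_tendsto_zero hα hL2 hXm
      hind hid hmean hvar hY0 hpath S] with ω ⟨T, hT⟩ hl hne
    have hr : Tendsto (fun n : ℕ => r / α ^ n) atTop (𝓝 0) :=
      tendsto_const_nhds.div_atTop (tendsto_pow_atTop_atTop_of_one_lt hα)
    refine lt_of_le_of_ne (le_of_tendsto_of_tendsto hr hl ?_) fun h0 => hne T hT (h0 ▸ hl)
    filter_upwards [eventually_ge_atTop T] with n hn
    exact div_le_div_of_nonneg_right (hT n hn).le (pow_pos (one_pos.trans hα) n).le
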